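/- Let $\mathcal X$ be a finite set (for instance $\mathcal X=[N]^D$), let $\mu,\nu$ be probability distributions on $\mathcal X$ with $\nu(x)>0$ for all $x$, and let $r=(r_t(y,x))_{t\in[0,1]}$ be the transition rate of a reference continuous-time Markov chain (CTMC) on $\mathcal X$ with initial distribution $p^r_0=\mu$. Here a CTMC with transition rate $u$ is a Markov process on $[0,1]$ with right-continuous paths with left limits, whose transition probabilities $p^u_{t|s}(y|x)$, $0\le s\le t\le 1$, are continuous in $s$ and in $t$ and satisfy $u_t(y,x)=\lim_{h\downarrow0}\big(p^u_{t+h|t}(y|x)-1_{y=x}\big)/h$ for $t\in[0,1)$; $p^u$ denotes its path measure. All CTMCs below start from $\mu$. For $g:\mathcal X\to\mathbb R$ consider $$\text{(SB)}\quad \min_{u:\;p^u_0=\mu,\;p^u_1=\nu}\mathrm{KL}(p^u\,\|\,p^r),\qquad\qquad \text{(SOC)}\quad \min_{u:\;p^u_0=\mu}\Big\{\mathrm{KL}(p^u\,\|\,p^r)+\mathbb E_{X\sim p^u}\,g(X_1)\Big\}.$$ Call non-negative functions $(\varphi_t,\widehat\varphi_t)_{t\in[0,1]}$ on $\mathcal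 X$ *SB potentials* if for all $0\le s<t\le1$ and $x\in\mathcal X$ $$\varphi_s(x)=\sum_y p^r_{t|s}(y|x)\,\varphi_t(y),\qquad \widehat\varphi_t(x)=\sum_y p^r_{t|s}(x|y)\,\widehat\varphi_s(y),\qquad \varphi_0\widehat\varphi_0=\mu,\qquad \varphi_1\widehat\varphi_1=\nu .$$ **Theorem.** If $p^r_{1|0}(y|x)>0$ for all $x,y\in\mathcal X$, then SB potentials exist. For any SB potentials $(\varphi,\widehat\varphi)$, let $u^\star$ be the rate $$u^\star_t(y,x)=\frac{\varphi_t(y)}{\varphi_t(x)}\,r_t(y,x)\quad(y\ne x),\qquad u^\star_t(x,x)=-\sum_{y\neq x}u^\star_t(y,x).$$ Then $u^\star$ is an optimal transition rate for (SB), and $u^\star$ solves (SOC) with terminal cost $g=\log\frac{\widehat\varphi_1}{\nu}$. Moreover, every optimal transition rate for (SB) solves (SOC) with this terminal cost. -/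

import Mathlib

open MeasureTheory Filter Topology
open scoped ENNReal

noncomputable section

/-- `IsTransitionFunction u p`: the numbers `p s t y x = p_{t|s}(y|x)`, `0 ≤ s ≤ t ≤ 1`, are the
transition probabilities of a continuous-time Markov chain on the finite set `X` whose transition
rate is `u t y x = u_t(y, x)` (the rate of going from `x` to `y` at time `t`), i.e.
`u_t(y, x) = lim_{h ↓ 0} (p_{t+h|t}(y|x) - 1_{y = x}) / h` for every `t ∈ [0, 1)`.
Continuity in both time variables excludes jumps at deterministic times, which a (right) limit
of difference quotients does not see. -/
structure IsTransitionFunction {X : Type*} [Fintype X] [DecidableEq X]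
    (u : ℝ → X → X → ℝ) (p : ℝ → ℝ → X → X → ℝ) : Prop where
  nonneg : ∀ s t, 0 ≤ s → s ≤ t → t ≤ 1 → ∀ y x, 0 ≤ p s t y x
  sum_eq_one : ∀ s t, 0 ≤ s → s ≤ t → t ≤ 1 → ∀ x, ∑ y, p s t y x = 1
  refl : ∀ s, 0 ≤ s → s ≤ 1 → ∀ y x, p s s y x = if y = x then 1 else 0
  chapman_kolmogorov : ∀ s t v, 0 ≤ s → s ≤ t → t ≤ v → v ≤ 1 → ∀ y x,
    p s v y x = ∑ z, p t v y z * p s t z x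
  continuousOn_right : ∀ s, 0 ≤ s → s ≤ 1 → ∀ y x,
    ContinuousOn (fun t => p s t y x) (Set.Icc s 1)
  continuousOn_left : ∀ t, 0 ≤ t → t ≤ 1 → ∀ y x,
    ContinuousOn (fun s => p s t y x) (Set.Icc 0 t)
  rate : ∀ t, 0 ≤ t → t < 1 → ∀ y x,
    Tendsto (fun h => (p t (t + h) y x - if y = x then 1 else 0) / h) (𝓝[>] 0) (𝓝 (u t y x))

/-- Right-continuous paths with left limits, from `[0, 1]` to the discrete set `X`. -/
structure CadlagPath (X : Type*) where
  toFun : unitInterval → X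
  rightCont_leftLim : ∀ t, (∀ᶠ s in 𝓝[>] t, toFun s = toFun t) ∧
    ∃ l, ∀ᶠ s in 𝓝[<] t, toFun s = l

/-- The σ-algebra on path space generated by the evaluations `ω ↦ ω t`. -/
instance CadlagPath.instMeasurableSpace (X : Type*) : MeasurableSpace (CadlagPath X) :=
  ⨆ t : unitInterval, MeasurableSpace.comap (fun ω : CadlagPath X => ω.toFun t) ⊤

/-- `P` is the law of the Markov chain with initial distribution `μ` and transition
probabilities `p`: for times `0 = t₀ ≤ t₁ ≤ … ≤ tₙ ≤ 1`,
`P(X_{t₀} = x₀, …, X_{tₙ} = xₙ) = μ(x₀) ∏ p_{tᵢ₊₁|tᵢ}(xᵢ₊₁|xᵢ)`. -/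
def IsMarkovLaw {X : Type*} (μ : X → ℝ) (p : ℝ → ℝ → X → X → ℝ)
    (P : Measure (CadlagPath X)) : Prop :=
  ∀ (n : ℕ) (t : Fin (n + 1) → unitInterval) (x : Fin (n + 1) → X), Monotone t → t 0 = 0 →
    P {ω | ∀ i, ω.toFun (t i) = x i} =
      ENNReal.ofReal (μ (x 0) *
        ∏ i : Fin n, p (t i.castSucc) (t i.succ) (x i.succ) (x i.castSucc))

/-- `P = p^u`: the path measure of the continuous-time Markov chain with initial distribution `μ`
and transition rate `u`. -/
def IsPathMeasure {X : Type*} [Fintype X] [DecidableEq X] (μ : X → ℝ) (u : ℝ → X → X → ℝ)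
    (P : Measure (CadlagPath X)) : Prop :=
  ∃ p, IsTransitionFunction u p ∧ IsMarkovLaw μ p P

/-- The law of `X_1` under `P` is `ν`. -/
def HasTerminalLaw {X : Type*} (ν : X → ℝ) (P : Measure (CadlagPath X)) : Prop :=
  ∀ x, P {ω | ω.toFun 1 = x} = ENNReal.ofReal (ν x)

/-- `u` solves the Schrödinger bridge problem
`min {KL(p^u ‖ p^r) : p^u_0 = μ, p^u_1 = ν}`, where `R = p^r`. -/
def IsSBSolution {X : Type*} [Fintype X] [DecidableEq X] (R : Measure (CadlagPath X))
    (μ ν : X → ℝ) (u : ℝ → X → X → ℝ) : Prop :=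
  ∃ P, IsPathMeasure μ u P ∧ HasTerminalLaw ν P ∧
    ∀ u' P', IsPathMeasure μ u' P' → HasTerminalLaw ν P' →
      InformationTheory.klDiv P R ≤ InformationTheory.klDiv P' R

/-- The stochastic optimal control objective `KL(P ‖ R) + E_{X ∼ P} g(X_1)`. -/
def socCost {X : Type*} (R : Measure (CadlagPath X)) (g : X → ℝ)
    (P : Measure (CadlagPath X)) : EReal :=
  (InformationTheory.klDiv P R : EReal) + ((∫ ω, g (ω.toFun 1) ∂P : ℝ) : EReal)

/-- `u` solves the stochastic optimal control problem
`min {KL(p^u ‖ p^r) + E_{X ∼ p^u} g(X_1) : p^u_0 = μ}`, where `R = p^r`. -/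
def IsSOCSolution {X : Type*} [Fintype X] [DecidableEq X] (R : Measure (CadlagPath X))
    (μ : X → ℝ) (g : X → ℝ) (u : ℝ → X → X → ℝ) : Prop :=
  ∃ P, IsPathMeasure μ u P ∧
    ∀ u' P', IsPathMeasure μ u' P' → socCost R g P ≤ socCost R g P'

/-- `(φ, φh)` are Schrödinger bridge potentials for the reference transition probabilities `p`
and the boundary marginals `μ`, `ν`. -/
structure IsSBPotentials {X : Type*} [Fintype X] (p : ℝ → ℝ → X → X → ℝ) (μ ν : X → ℝ)
    (φ φh : ℝ → X → ℝ) : Prop where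
  nonneg : ∀ t, 0 ≤ t → t ≤ 1 → ∀ x, 0 ≤ φ t x
  nonneg_hat : ∀ t, 0 ≤ t → t ≤ 1 → ∀ x, 0 ≤ φh t x
  backward : ∀ s t, 0 ≤ s → s < t → t ≤ 1 → ∀ x, φ s x = ∑ y, p s t y x * φ t y
  forward : ∀ s t, 0 ≤ s → s < t → t ≤ 1 → ∀ x, φh t x = ∑ y, p s t x y * φh s y
  initial : ∀ x, φ 0 x * φh 0 x = μ x
  terminal : ∀ x, φ 1 x * φh 1 x = ν x

/-- The rate `u⋆_t(y, x) = (φ_t(y) / φ_t(x)) r_t(y, x)` for `y ≠ x`; the diagonal is minus the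
total rate of leaving `x`. -/
def sbRate {X : Type*} [Fintype X] [DecidableEq X] (r : ℝ → X → X → ℝ) (φ : ℝ → X → ℝ) :
    ℝ → X → X → ℝ := fun t y x =>
  if y = x then -∑ z ∈ Finset.univ.erase x, φ t z / φ t x * r t z x
  else φ t y / φ t x * r t y x

end

/-! Put `f = logDensity φ`, that is `log φ_1(X_1) - log φ_0(X_0)`. The backward equation makes `exp
f` a probability density with respect to `R`, and the tilted law `P` is the Markov law of the Doob
transform of `p` by `φ`, with rate `sbRate r φ` and terminal law `ν`
(`IsSBPotentials.exists_pathMeasure`). Gibbs' inequality (`integral_le_toReal_klDiv`) gives `KL(P' ‖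
R) ≥ E_{P'} f`, with equality at `P`. Every competitor starts from `μ` and the terminal cost is `g =
-log φ_1`, so `E_{P'} f = -E_{P'} g(X_1) - const`: hence `P` is optimal for (SOC). Among laws ending
in `ν` the term `E g(X_1)` is constant too, so `P` is optimal for (SB), and any (SB) optimum costs
no more than `P` in (SOC). Existence of potentials reduces to a static system for the kernel `p 0
1`, solved by `exists_schrodinger_system`. -/

/-! ### Existence of potentials. -/

/-- The Schrödinger system with a positive kernel `K` has a solution: the maximiser over the
simplex of `b ↦ ∏ b(y)^ν(y) / ∏ (K b)(x)^μ(x)` is positive, hence a critical point. -/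
theorem exists_schrodinger_system {X : Type*} [Fintype X]
    (K : X → X → ℝ) (hK : ∀ x y, 0 < K x y) (μ ν : X → ℝ) (hμ : μ ∈ stdSimplex ℝ X)
    (hν : ν ∈ stdSimplex ℝ X) (hν_pos : ∀ x, 0 < ν x) :
    ∃ a b : X → ℝ, (∀ x, 0 ≤ a x) ∧ (∀ y, 0 < b y) ∧
      (∀ x, a x * ∑ y, K x y * b y = μ x) ∧ ∀ y, b y * ∑ x, K x y * a x = ν y := by
  classical
  have hS : ∀ b ∈ stdSimplex ℝ X, ∀ x, 0 < ∑ y, K x y * b y := by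
    intro b hb x
    have hb0 : ∑ y, b y ≠ 0 := by rw [hb.2]; exact one_ne_zero
    obtain ⟨y, -, hy⟩ := Finset.exists_ne_zero_of_sum_ne_zero hb0
    exact Finset.sum_pos' (fun z _ => mul_nonneg (hK x z).le (hb.1 z))
      ⟨y, Finset.mem_univ _, mul_pos (hK x y) ((hb.1 y).lt_of_ne' hy)⟩
  -- Real powers, unlike logarithms, stay continuous up to the boundary of the simplex, so
  -- compactness applies.
  let G : (X → ℝ) → ℝ := fun b => (∏ y, b y ^ ν y) / ∏ x, (∑ y, K x y * b y) ^ μ x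
  have hGc : ContinuousOn G (stdSimplex ℝ X) := by
    refine ContinuousOn.div ?_ ?_ ?_
    · exact continuousOn_finsetProd _ fun y _ => ((continuous_apply y).continuousOn).rpow_const
        fun _ _ => Or.inr (hν_pos y).le
    · refine continuousOn_finsetProd _ fun x _ => ContinuousOn.rpow_const ?_ ?_
      · fun_prop
      · exact fun b hb => Or.inl (hS b hb x).ne'
    · exact fun b hb => Finset.prod_ne_zero_iff.2 fun x _ => (Real.rpow_pos_of_pos (hS b hb x) _).ne'
  obtain ⟨b, hb, hmax⟩ := (isCompact_stdSimplex ℝ X).exists_isMaxOn ⟨ν, hν⟩ hGc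
  have hGpos : ∀ b ∈ stdSimplex ℝ X, (∀ y, 0 < b y) → 0 < G b := fun b hb hb' =>
    div_pos (Finset.prod_pos fun y _ => Real.rpow_pos_of_pos (hb' y) _)
      (Finset.prod_pos fun x _ => Real.rpow_pos_of_pos (hS b hb x) _)
  have hbpos : ∀ y, 0 < b y := by
    intro y
    refine (hb.1 y).lt_of_ne' fun hy => ?_
    have h1 : 0 < G b := (hGpos ν hν hν_pos).trans_le (hmax hν)
    refine h1.ne' ?_
    simp only [G]
    rw [Finset.prod_eq_zero (Finset.mem_univ y), zero_div]
    rw [hy, Real.zero_rpow (hν_pos y).ne']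
  have hlogG : ∀ c ∈ stdSimplex ℝ X, (∀ y, 0 < c y) → Real.log (G c) =
      ∑ y, ν y * Real.log (c y) - ∑ x, μ x * Real.log (∑ y, K x y * c y) := by
    intro c hc hc'
    simp only [G]
    rw [Real.log_div, Real.log_prod, Real.log_prod]
    · simp only [Real.log_rpow (hc' _), Real.log_rpow (hS c hc _)]
    · exact fun x _ => (Real.rpow_pos_of_pos (hS c hc x) _).ne'
    · exact fun x _ => (Real.rpow_pos_of_pos (hc' x) _).ne'
    · exact (Finset.prod_pos fun y _ => Real.rpow_pos_of_pos (hc' y) _).ne'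
    · exact (Finset.prod_pos fun x _ => Real.rpow_pos_of_pos (hS c hc x) _).ne'
  set S : X → ℝ := fun x => ∑ y, K x y * b y with hSdef
  have hSpos : ∀ x, 0 < S x := hS b hb
  refine ⟨fun x => μ x / S x, b, fun x => div_nonneg (hμ.1 x) (hSpos x).le, hbpos,
    fun x => div_mul_cancel₀ _ (hSpos x).ne', fun y => ?_⟩
  -- Moving from `b` towards the vertex `y` keeps the total mass equal to one, so no Lagrange
  -- multiplier is needed. As `b` is interior, both signs of `h` are allowed. The derivative at 0 is
  -- `(ν y / b y - 1) - (∑ x, K x y * (μ x / S x) - 1)`, and its vanishing is the second equation of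
  -- the system.
  let e : X → ℝ := fun z => if z = y then 1 else 0
  let c : ℝ → X → ℝ := fun h z => b z + h * (e z - b z)
  have hcK : ∀ h x, ∑ z, K x z * c h z = S x + h * (K x y - S x) := by
    intro h x
    have : ∑ z, K x z * e z = K x y := by simp [e]
    rw [← this, hSdef]
    simp only [c, mul_add, mul_sub, Finset.sum_add_distrib, Finset.sum_sub_distrib, Finset.mul_sum]
    simp only [mul_left_comm]
  have hc1 : ∀ h, ∑ z, c h z = 1 := by
    intro h
    have h1 : ∑ z, e z = 1 := by simp [e]
    simp only [c, Finset.sum_add_distrib, ← Finset.mul_sum, Finset.sum_sub_distrib, h1, hb.2]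
    ring
  have hcpos : ∀ᶠ h in 𝓝 (0 : ℝ), ∀ z, 0 < c h z := by
    refine eventually_all.2 fun z => ?_
    have : ContinuousAt (fun h => c h z) 0 := by
      simp only [c]; fun_prop
    refine this.eventually (lt_mem_nhds ?_)
    simpa [c] using hbpos z
  let F : ℝ → ℝ := fun h =>
    ∑ z, ν z * Real.log (b z + h * (e z - b z)) - ∑ x, μ x * Real.log (S x + h * (K x y - S x))
  have hFG : ∀ h, (∀ z, 0 < c h z) → F h = Real.log (G (c h)) := by
    intro h hh
    rw [hlogG _ ⟨fun z => (hh z).le, hc1 h⟩ hh]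
    simp only [hcK, F, c]
  have hloc : IsLocalMax F 0 := by
    filter_upwards [hcpos] with h hh
    have hc0 : c 0 = b := by funext z; simp [c]
    rw [hFG h hh, hFG 0 (by rw [hc0]; exact hbpos), hc0]
    exact Real.log_le_log (hGpos _ ⟨fun z => (hh z).le, hc1 h⟩ hh)
      (hmax (show c h ∈ stdSimplex ℝ X from ⟨fun z => (hh z).le, hc1 h⟩))
  have hlog : ∀ w v : ℝ, 0 < w →
      HasDerivAt (fun h => Real.log (w + h * v)) (v / w) 0 := by
    intro w v hw
    have h1 : HasDerivAt (fun h : ℝ => w + h * v) v 0 := by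
      simpa using ((hasDerivAt_id (0 : ℝ)).mul_const v).const_add w
    simpa using h1.log (by simpa using hw.ne')
  have hder : HasDerivAt F (∑ z, ν z * ((e z - b z) / b z) - ∑ x, μ x * ((K x y - S x) / S x)) 0 :=
    (HasDerivAt.fun_sum fun z _ => (hlog _ _ (hbpos z)).const_mul (ν z)).sub
      (HasDerivAt.fun_sum fun x _ => (hlog _ _ (hSpos x)).const_mul (μ x))
  have h0 := hloc.hasDerivAt_eq_zero hder
  have h1 : ∑ z, ν z * ((e z - b z) / b z) = ν y / b y - 1 := by
    have : ∀ z, ν z * ((e z - b z) / b z) = (if z = y then ν z / b z else 0) - ν z := by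
      intro z
      have := (hbpos z).ne'
      simp only [e]
      split_ifs <;> field_simp
      ring
    simp only [this, Finset.sum_sub_distrib, hν.2]
    simp
  have h2 : ∑ x, μ x * ((K x y - S x) / S x) = ∑ x, K x y * (μ x / S x) - 1 := by
    have : ∀ x, μ x * ((K x y - S x) / S x) = K x y * (μ x / S x) - μ x := by
      intro x
      have := (hSpos x).ne'
      field_simp
    simp only [this, Finset.sum_sub_distrib, hμ.2]
  rw [h1, h2] at h0
  have h3 : ∑ x, K x y * (μ x / S x) = ν y / b y := by linarith
  rw [h3, mul_div_cancel₀ _ (hbpos y).ne']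

theorem exists_isSBPotentials {X : Type*} [Fintype X] [DecidableEq X]
    {μ ν : X → ℝ} (hμ : μ ∈ stdSimplex ℝ X) (hν : ν ∈ stdSimplex ℝ X) (hν_pos : ∀ x, 0 < ν x)
    {r : ℝ → X → X → ℝ} {p : ℝ → ℝ → X → X → ℝ} (hp : IsTransitionFunction r p)
    (hpos : ∀ x y, 0 < p 0 1 y x) : ∃ φ φh, IsSBPotentials p μ ν φ φh := by
  obtain ⟨a, b, ha, hb, hab, hba⟩ :=
    exists_schrodinger_system (fun x y => p 0 1 y x) hpos μ ν hμ hν hν_pos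
  -- Propagate `b` backward from time 1 and `a` forward from time 0; the boundary conditions are
  -- then the static system.
  refine ⟨fun t x => ∑ y, p t 1 y x * b y, fun t x => ∑ y, p 0 t x y * a y, ?_, ?_, ?_, ?_, ?_, ?_⟩
  · exact fun t h0 h1 x => Finset.sum_nonneg fun y _ =>
      mul_nonneg (hp.nonneg t 1 h0 h1 le_rfl y x) (hb y).le
  · exact fun t h0 h1 x => Finset.sum_nonneg fun y _ =>
      mul_nonneg (hp.nonneg 0 t le_rfl h0 h1 x y) (ha y)
  · intro s t hs hst ht x
    simp only [hp.chapman_kolmogorov s t 1 hs hst.le ht le_rfl, Finset.sum_mul, Finset.mul_sum]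
    rw [Finset.sum_comm]
    exact Finset.sum_congr rfl fun y _ => Finset.sum_congr rfl fun z _ => by ring
  · intro s t hs hst ht x
    simp only [hp.chapman_kolmogorov 0 s t le_rfl hs hst.le ht, Finset.sum_mul, Finset.mul_sum]
    rw [Finset.sum_comm]
    exact Finset.sum_congr rfl fun y _ => Finset.sum_congr rfl fun z _ => by ring
  · intro x
    simp only [hp.refl 0 le_rfl zero_le_one]
    simpa [mul_comm] using hab x
  · intro x
    simp only [hp.refl 1 zero_le_one le_rfl]
    simpa using hba x

/-! ### Events and integrals on path space. -/

section PathSpace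

variable {X : Type*}

theorem CadlagPath.measurableSet_eval_eq (t : unitInterval) (x : X) :
    MeasurableSet {ω : CadlagPath X | ω.toFun t = x} := by
  have h : MeasurableSpace.comap (fun ω : CadlagPath X => ω.toFun t) ⊤ ≤
      CadlagPath.instMeasurableSpace X :=
    le_iSup (fun t : unitInterval =>
      MeasurableSpace.comap (fun ω : CadlagPath X => ω.toFun t) ⊤) t
  exact h _ ⟨{x}, trivial, rfl⟩

theorem CadlagPath.measurable_comp_eval {β : Type*} [MeasurableSpace β] (g : X → β)
    (t : unitInterval) : Measurable fun ω : CadlagPath X => g (ω.toFun t) := by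
  intro s _
  have h : MeasurableSpace.comap (fun ω : CadlagPath X => ω.toFun t) ⊤ ≤
      CadlagPath.instMeasurableSpace X :=
    le_iSup (fun t : unitInterval =>
      MeasurableSpace.comap (fun ω : CadlagPath X => ω.toFun t) ⊤) t
  exact h _ ⟨g ⁻¹' s, trivial, rfl⟩

variable [Fintype X]

theorem CadlagPath.measure_eq_sum_inter_eval (P : Measure (CadlagPath X)) (t : unitInterval)
    {A : Set (CadlagPath X)} (hA : MeasurableSet A) :
    P A = ∑ x, P (A ∩ {ω | ω.toFun t = x}) := by
  rw [← tsum_fintype (L := .unconditional _), ← measure_iUnion]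
  · congr 1
    ext ω
    simp
  · intro x y hxy
    refine Set.disjoint_left.2 fun ω h1 h2 => hxy ?_
    exact h1.2.symm.trans h2.2
  · exact fun x => hA.inter (measurableSet_eval_eq t x)

theorem CadlagPath.integrable_comp_eval (P : Measure (CadlagPath X)) [IsFiniteMeasure P]
    (g : X → ℝ) (t : unitInterval) : Integrable (fun ω => g (ω.toFun t)) P := by
  refine Integrable.of_bound (measurable_comp_eval g t).aestronglyMeasurable (∑ x, ‖g x‖)
    (ae_of_all _ fun ω => ?_)
  exact Finset.single_le_sum (f := fun x => ‖g x‖) (fun _ _ => norm_nonneg _) (Finset.mem_univ _)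

theorem CadlagPath.integral_comp_eval (P : Measure (CadlagPath X)) [IsFiniteMeasure P]
    {m : X → ℝ} (hm : ∀ x, 0 ≤ m x) {t : unitInterval}
    (hP : ∀ x, P {ω | ω.toFun t = x} = ENNReal.ofReal (m x)) (g : X → ℝ) :
    ∫ ω, g (ω.toFun t) ∂P = ∑ x, m x * g x := by
  classical
  have h : (fun ω : CadlagPath X => g (ω.toFun t)) =
      fun ω => ∑ x, Set.indicator {ω : CadlagPath X | ω.toFun t = x} (fun _ => g x) ω := by
    funext ω
    simp [Set.indicator_apply]
  rw [h, integral_finsetSum]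
  · refine Finset.sum_congr rfl fun x _ => ?_
    rw [integral_indicator_const _ (measurableSet_eval_eq t x), measureReal_def, hP,
      ENNReal.toReal_ofReal (hm x), smul_eq_mul]
  · exact fun x _ => (integrable_const _).indicator (measurableSet_eval_eq t x)

end PathSpace

/-! ### Marginals of Markov laws. -/

section MarkovLaw

variable {X : Type*} {μ : X → ℝ} {p : ℝ → ℝ → X → X → ℝ} {P : Measure (CadlagPath X)}

theorem IsMarkovLaw.measure_eval_zero (hP : IsMarkovLaw μ p P) (x : X) :
    P {ω | ω.toFun 0 = x} = ENNReal.ofReal (μ x) := by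
  have h := hP 0 (fun _ => 0) (fun _ => x) (fun _ _ _ => le_rfl) rfl
  simpa using h

theorem IsMarkovLaw.isProbabilityMeasure [Fintype X] (hμ : μ ∈ stdSimplex ℝ X)
    (hP : IsMarkovLaw μ p P) : IsProbabilityMeasure P := by
  constructor
  rw [CadlagPath.measure_eq_sum_inter_eval P 0 MeasurableSet.univ]
  simp only [Set.univ_inter, hP.measure_eval_zero]
  rw [← ENNReal.ofReal_sum_of_nonneg fun x _ => hμ.1 x, hμ.2, ENNReal.ofReal_one]

theorem IsMarkovLaw.measure_eval_one [Fintype X] (hP : IsMarkovLaw μ p P)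
    (hμ : ∀ x, 0 ≤ μ x) (hp : ∀ x y, 0 ≤ p 0 1 y x) (y : X) :
    P {ω | ω.toFun 1 = y} = ENNReal.ofReal (∑ x, μ x * p 0 1 y x) := by
  rw [CadlagPath.measure_eq_sum_inter_eval P 0 (CadlagPath.measurableSet_eval_eq 1 y),
    ENNReal.ofReal_sum_of_nonneg fun x _ => mul_nonneg (hμ x) (hp x y)]
  refine Finset.sum_congr rfl fun x _ => ?_
  have h := hP 1 ![0, 1] ![x, y] (by intro i j hij; fin_cases i <;> fin_cases j <;> simp_all) rfl
  simpa [Fin.forall_fin_two, Set.inter_def, and_comm] using h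

/-- Appending the time `1` to the finite-dimensional distributions. -/
theorem IsMarkovLaw.measure_inter_eval_one (hP : IsMarkovLaw μ p P) {n : ℕ}
    {t : Fin (n + 1) → unitInterval} (x : Fin (n + 1) → X) (ht : Monotone t) (h0 : t 0 = 0)
    (y : X) :
    P ({ω | ∀ i, ω.toFun (t i) = x i} ∩ {ω | ω.toFun 1 = y}) =
      ENNReal.ofReal (μ (x 0) *
        ((∏ i : Fin n, p (t i.castSucc) (t i.succ) (x i.succ) (x i.castSucc)) *
          p (t (Fin.last n)) 1 y (x (Fin.last n)))) := by
  have hmono : Monotone (Fin.snoc (α := fun _ => unitInterval) t 1) := by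
    refine Fin.monotone_iff_le_succ.2 fun i => ?_
    induction i using Fin.lastCases with
    | last => rw [Fin.succ_last, Fin.snoc_last]; exact unitInterval.le_one'
    | cast i =>
      rw [Fin.succ_castSucc, Fin.snoc_castSucc, Fin.snoc_castSucc]
      exact ht (Fin.castSucc_le_succ i)
  have h := hP (n + 1) (Fin.snoc (α := fun _ => unitInterval) t 1) (Fin.snoc (α := fun _ => X) x y)
    hmono (by rw [← Fin.castSucc_zero, Fin.snoc_castSucc, h0])
  rw [Fin.prod_univ_castSucc, ← Fin.castSucc_zero] at h
  simp only [Fin.succ_castSucc, Fin.snoc_castSucc, Fin.succ_last, Fin.snoc_last] at h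
  rw [Set.Icc.coe_one] at h
  rw [← h]
  congr 1
  ext ω
  simp [Fin.forall_fin_succ', -Fin.castSucc_zero]

end MarkovLaw

/-! ### Gibbs variational principle. -/

section Gibbs

variable {α : Type*} [MeasurableSpace α]

theorem klDiv_tilted_self {R : Measure α} [IsProbabilityMeasure R] {f : α → ℝ}
    (hexp : Integrable (fun x => Real.exp (f x)) R) (hone : ∫ x, Real.exp (f x) ∂(R) = 1)
    (hf : Integrable f (R.tilted f)) :
    InformationTheory.klDiv (R.tilted f) R ≠ ∞ ∧
      (InformationTheory.klDiv (R.tilted f) R).toReal = ∫ x, f x ∂(R.tilted f) := by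
  have hprob : IsProbabilityMeasure (R.tilted f) := isProbabilityMeasure_tilted hexp
  have hac := tilted_absolutelyContinuous R f
  have hllr : llr (R.tilted f) R =ᵐ[R.tilted f] f := by
    filter_upwards [hac.ae_le (log_rnDeriv_tilted_left_self hexp)] with x hx
    rw [llr, hx, hone, Real.log_one, sub_zero]
  refine ⟨InformationTheory.klDiv_ne_top hac ((integrable_congr hllr).2 hf), ?_⟩
  rw [InformationTheory.toReal_klDiv_of_measure_eq hac (by simp), integral_congr_ae hllr]

/-- The gap between the two sides is `KL(P ‖ R.tilted f)`, which is nonnegative. -/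
theorem integral_le_toReal_klDiv {R P : Measure α} [IsProbabilityMeasure R]
    [IsProbabilityMeasure P] {f : α → ℝ} (hexp : Integrable (fun x => Real.exp (f x)) R)
    (hone : ∫ x, Real.exp (f x) ∂(R) = 1) (hf : Integrable f P)
    (h : InformationTheory.klDiv P R ≠ ∞) :
    ∫ x, f x ∂P ≤ (InformationTheory.klDiv P R).toReal := by
  have hprob : IsProbabilityMeasure (R.tilted f) := isProbabilityMeasure_tilted hexp
  obtain ⟨hac, hint⟩ := InformationTheory.klDiv_ne_top_iff.1 h
  have h1 := InformationTheory.integral_llr_add_sub_measure_univ_nonneg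
    (hac.trans (absolutelyContinuous_tilted hexp))
    (integrable_llr_tilted_right hac hf hint hexp)
  rw [integral_llr_tilted_right hac hf hexp hint, hone] at h1
  rw [InformationTheory.toReal_klDiv_of_measure_eq hac (by simp)]
  simpa using h1

end Gibbs

/-! ### Doob transform and its path density. -/

/-- The transition probabilities of the Doob `h`-transform of `p` by `φ`. -/
noncomputable def doobTransform {X : Type*} (p : ℝ → ℝ → X → X → ℝ) (φ : ℝ → X → ℝ) :
    ℝ → ℝ → X → X → ℝ :=
  fun s t y x => p s t y x * (φ t y / φ s x)

theorem Fin.prod_succ_div_castSucc {n : ℕ} (c : Fin (n + 1) → ℝ) (hc : ∀ i, c i ≠ 0) :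
    ∏ i : Fin n, c i.succ / c i.castSucc = c (Fin.last n) / c 0 := by
  induction n with
  | zero => simp [hc]
  | succ n ih =>
    rw [Fin.prod_univ_castSucc]
    have h1 := ih (fun i => c i.castSucc) fun i => hc _
    simp only [← Fin.succ_castSucc] at h1
    rw [h1, Fin.succ_last, Fin.castSucc_zero]
    field_simp [hc]

/-- The log-density of the law of the Doob transform with respect to the reference law. -/
noncomputable def logDensity {X : Type*} (φ : ℝ → X → ℝ) (ω : CadlagPath X) : ℝ :=
  Real.log (φ 1 (ω.toFun 1)) - Real.log (φ 0 (ω.toFun 0))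

theorem measurable_logDensity {X : Type*} (φ : ℝ → X → ℝ) : Measurable (logDensity φ) :=
  (CadlagPath.measurable_comp_eval (fun x => Real.log (φ 1 x)) 1).sub
    (CadlagPath.measurable_comp_eval (fun x => Real.log (φ 0 x)) 0)

theorem integrable_logDensity {X : Type*} [Fintype X] (φ : ℝ → X → ℝ)
    (P : Measure (CadlagPath X)) [IsFiniteMeasure P] : Integrable (logDensity φ) P :=
  (CadlagPath.integrable_comp_eval P (fun x => Real.log (φ 1 x)) 1).sub
    (CadlagPath.integrable_comp_eval P (fun x => Real.log (φ 0 x)) 0)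

/-! ### From potentials to the law of the transformed chain. -/

section Potentials

variable {X : Type*} [Fintype X] {p : ℝ → ℝ → X → X → ℝ} {μ ν : X → ℝ} {φ φh : ℝ → X → ℝ}

theorem IsSBPotentials.terminal_pos (h : IsSBPotentials p μ ν φ φh) (hν : ∀ x, 0 < ν x) (x : X) :
    0 < φ 1 x := by
  refine (h.nonneg 1 zero_le_one le_rfl x).lt_of_ne' fun h0 => ?_
  have h1 := h.terminal x
  rw [h0, zero_mul] at h1
  exact (hν x).ne h1

theorem IsSBPotentials.log_hat_div (h : IsSBPotentials p μ ν φ φh) (hν : ∀ x, 0 < ν x) (x : X) :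
    Real.log (φh 1 x / ν x) = -Real.log (φ 1 x) := by
  have h1 := h.terminal x
  have h2 : φh 1 x ≠ 0 := fun h0 => (hν x).ne' (by rw [← h1, h0, mul_zero])
  rw [← h1, ← Real.log_inv, div_mul_cancel_right₀ h2]

variable [DecidableEq X] {r : ℝ → X → X → ℝ}

theorem IsSBPotentials.backward_of_le (h : IsSBPotentials p μ ν φ φh)
    (hp : IsTransitionFunction r p) {s t : ℝ} (hs : 0 ≤ s) (hst : s ≤ t) (ht : t ≤ 1) (x : X) :
    φ s x = ∑ y, p s t y x * φ t y := by
  rcases hst.lt_or_eq with hst | rfl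
  · exact h.backward s t hs hst ht x
  · simp [hp.refl s hs ht]

/-- `φ t` averages the positive function `φ 1` against the probability vector `p t 1 · x`. -/
theorem IsSBPotentials.pos (h : IsSBPotentials p μ ν φ φh) (hp : IsTransitionFunction r p)
    (hν : ∀ x, 0 < ν x) {t : ℝ} (h0 : 0 ≤ t) (h1 : t ≤ 1) (x : X) : 0 < φ t x := by
  rw [h.backward_of_le hp h0 h1 le_rfl]
  have hsum : ∑ y, p t 1 y x ≠ 0 := by rw [hp.sum_eq_one t 1 h0 h1 le_rfl]; exact one_ne_zero
  obtain ⟨y, -, hy⟩ := Finset.exists_ne_zero_of_sum_ne_zero hsum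
  have hnn := fun z => hp.nonneg t 1 h0 h1 le_rfl z x
  exact Finset.sum_pos' (fun z _ => mul_nonneg (hnn z) (h.terminal_pos hν z).le)
    ⟨y, Finset.mem_univ _, mul_pos ((hnn y).lt_of_ne' hy) (h.terminal_pos hν y)⟩

/-- `φ t` is `p t 1` applied to the fixed function `φ 1`, so it inherits the continuity of `p` in
its earlier time. -/
theorem IsSBPotentials.continuousOn (h : IsSBPotentials p μ ν φ φh)
    (hp : IsTransitionFunction r p) (x : X) : ContinuousOn (fun t => φ t x) (Set.Icc 0 1) := by
  have h1 : ContinuousOn (fun t => ∑ y, p t 1 y x * φ 1 y) (Set.Icc 0 1) :=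
    continuousOn_finsetSum _ fun y _ =>
      (hp.continuousOn_left 1 zero_le_one le_rfl y x).mul continuousOn_const
  exact h1.congr fun t ht => h.backward_of_le hp ht.1 ht.2 le_rfl x

/-- Mass one is the backward equation, and in Chapman–Kolmogorov the intermediate factors `φ t z`
cancel. Off the diagonal the rate needs only continuity of `φ` in time. -/
theorem IsSBPotentials.isTransitionFunction_doobTransform (h : IsSBPotentials p μ ν φ φh)
    (hp : IsTransitionFunction r p) (hν : ∀ x, 0 < ν x) :
    IsTransitionFunction (sbRate r φ) (doobTransform p φ) := by
  have hpos : ∀ {t : ℝ}, 0 ≤ t → t ≤ 1 → ∀ x, 0 < φ t x := fun h0 h1 x => h.pos hp hν h0 h1 x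
  have hsum : ∀ s t, 0 ≤ s → s ≤ t → t ≤ 1 → ∀ x, ∑ y, doobTransform p φ s t y x = 1 := by
    intro s t hs hst ht x
    simp only [doobTransform, ← mul_div_assoc]
    rw [← Finset.sum_div, ← h.backward_of_le hp hs hst ht,
      div_self (hpos hs (hst.trans ht) x).ne']
  have hoff : ∀ t, 0 ≤ t → t < 1 → ∀ y x, y ≠ x →
      Tendsto (fun k => doobTransform p φ t (t + k) y x / k) (𝓝[>] 0)
        (𝓝 (φ t y / φ t x * r t y x)) := by
    intro t h0 h1 y x hyx
    have hr := hp.rate t h0 h1 y x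
    simp only [if_neg hyx, sub_zero] at hr
    have hadd : Tendsto (fun k => t + k) (𝓝[>] 0) (𝓝[Set.Icc 0 1] t) := by
      refine tendsto_nhdsWithin_iff.2 ⟨?_, ?_⟩
      · have : Tendsto (fun k : ℝ => t + k) (𝓝 0) (𝓝 (t + 0)) :=
          (continuous_const.add continuous_id).tendsto 0
        rw [add_zero] at this
        exact this.mono_left nhdsWithin_le_nhds
      · filter_upwards [Ioo_mem_nhdsGT (sub_pos.2 h1)] with k hk
        exact ⟨by linarith [hk.1], by linarith [hk.2]⟩
    have hφ : Tendsto (fun k => φ (t + k) y) (𝓝[>] 0) (𝓝 (φ t y)) :=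
      (h.continuousOn hp y t ⟨h0, h1.le⟩).tendsto.comp hadd
    refine ((hφ.div_const (φ t x)).mul hr).congr fun k => ?_
    simp only [doobTransform]
    ring
  refine ⟨?_, hsum, ?_, ?_, ?_, ?_, ?_⟩
  · intro s t hs hst ht y x
    exact mul_nonneg (hp.nonneg s t hs hst ht y x)
      (div_pos (hpos (hs.trans hst) ht y) (hpos hs (hst.trans ht) x)).le
  · intro s h0 h1 y x
    simp only [doobTransform, hp.refl s h0 h1]
    split_ifs with hyx
    · rw [hyx, div_self (hpos h0 h1 x).ne', mul_one]
    · rw [zero_mul]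
  · intro s t v hs hst htv hv y x
    simp only [doobTransform]
    rw [hp.chapman_kolmogorov s t v hs hst htv hv, Finset.sum_mul]
    refine Finset.sum_congr rfl fun z _ => ?_
    have := (hpos (hs.trans hst) (htv.trans hv) z).ne'
    field_simp
  · intro s h0 h1 y x
    exact (hp.continuousOn_right s h0 h1 y x).mul
      (((h.continuousOn hp y).mono (Set.Icc_subset_Icc_left h0)).div_const _)
  · intro t h0 h1 y x
    exact (hp.continuousOn_left t h0 h1 y x).mul
      (continuousOn_const.div ((h.continuousOn hp x).mono (Set.Icc_subset_Icc_right h1))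
        fun s hs => (hpos hs.1 (hs.2.trans h1) x).ne')
  · intro t h0 h1 y x
    by_cases hyx : y = x
    · subst hyx
      simp only [sbRate, if_true]
      -- Conservation of mass reduces the diagonal rate to the others, which avoids differentiating
      -- `φ` in time.
      refine (tendsto_finsetSum (Finset.univ.erase y) fun z hz =>
        hoff t h0 h1 z y (Finset.ne_of_mem_erase hz)).neg.congr' ?_
      filter_upwards [Ioo_mem_nhdsGT (sub_pos.2 h1)] with k hk
      have h2 := hsum t (t + k) h0 (by linarith [hk.1]) (by linarith [hk.2]) y
      rw [← Finset.add_sum_erase _ _ (Finset.mem_univ y)] at h2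
      rw [← Finset.sum_div, ← neg_div, ← h2]
      congr 1
      ring
    · simp only [sbRate, if_neg hyx, sub_zero]
      exact hoff t h0 h1 y x hyx

/-- The terminal law of the Doob transform. -/
theorem IsSBPotentials.sum_mul_doobTransform (h : IsSBPotentials p μ ν φ φh)
    (hp : IsTransitionFunction r p) (hν : ∀ x, 0 < ν x) (y : X) :
    ∑ x, μ x * doobTransform p φ 0 1 y x = ν y := by
  rw [← h.terminal y, h.forward 0 1 le_rfl zero_lt_one le_rfl, Finset.mul_sum]
  refine Finset.sum_congr rfl fun x _ => ?_
  rw [← h.initial x, doobTransform]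
  have := (h.pos hp hν le_rfl zero_le_one x).ne'
  field_simp

theorem IsSBPotentials.exp_logDensity (h : IsSBPotentials p μ ν φ φh)
    (hp : IsTransitionFunction r p) (hν : ∀ x, 0 < ν x) (ω : CadlagPath X) :
    Real.exp (logDensity φ ω) = φ 1 (ω.toFun 1) / φ 0 (ω.toFun 0) := by
  rw [logDensity, Real.exp_sub, Real.exp_log (h.terminal_pos hν _),
    Real.exp_log (h.pos hp hν le_rfl zero_le_one _)]

/-- Slice the cylinder event by the value of `X_1`: the density is constant on each slice. Summing
over that value by the backward equation leaves `φ_{t_n}(x_n) / φ_0(x_0)`, the telescoped product of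
the Doob factors. -/
theorem IsSBPotentials.isMarkovLaw_withDensity (h : IsSBPotentials p μ ν φ φh)
    (hp : IsTransitionFunction r p) (hν : ∀ x, 0 < ν x) (hμ : ∀ x, 0 ≤ μ x)
    {R : Measure (CadlagPath X)} (hR : IsMarkovLaw μ p R) :
    IsMarkovLaw μ (doobTransform p φ)
      (R.withDensity fun ω => ENNReal.ofReal (Real.exp (logDensity φ ω))) := by
  intro n t x ht h0
  set A : Set (CadlagPath X) := {ω | ∀ i, ω.toFun (t i) = x i} with hA
  have hAm : MeasurableSet A := by
    rw [hA, Set.ofPred_forall]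
    exact MeasurableSet.iInter fun i => CadlagPath.measurableSet_eval_eq _ _
  have hpos : ∀ (s : unitInterval) z, 0 < φ s z := fun s z => h.pos hp hν s.2.1 s.2.2 z
  have hprod : 0 ≤ ∏ i : Fin n, p (t i.castSucc) (t i.succ) (x i.succ) (x i.castSucc) :=
    Finset.prod_nonneg fun i _ => hp.nonneg _ _ (t _).2.1 (ht (Fin.castSucc_le_succ i)) (t _).2.2 _ _
  have hfib : ∀ y, (R.withDensity fun ω => ENNReal.ofReal (Real.exp (logDensity φ ω)))
      (A ∩ {ω | ω.toFun 1 = y}) = ENNReal.ofReal (μ (x 0) *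
        (∏ i : Fin n, p (t i.castSucc) (t i.succ) (x i.succ) (x i.castSucc)) / φ 0 (x 0) *
          (p (t (Fin.last n)) 1 y (x (Fin.last n)) * φ 1 y)) := by
    intro y
    have hm := hAm.inter (CadlagPath.measurableSet_eval_eq 1 y)
    rw [withDensity_apply _ hm, setLIntegral_congr_fun hm
      (g := fun _ => ENNReal.ofReal (φ 1 y / φ 0 (x 0))), setLIntegral_const,
      hR.measure_inter_eval_one x ht h0, ← ENNReal.ofReal_mul]
    · congr 1
      ring
    · exact (div_pos (h.terminal_pos hν y) (h.pos hp hν le_rfl zero_le_one _)).le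
    · intro ω hω
      have h1 : ω.toFun 0 = x 0 := by rw [← h0]; exact hω.1 0
      have h2 : ω.toFun 1 = y := hω.2
      simp only [h.exp_logDensity hp hν, h1, h2]
  rw [CadlagPath.measure_eq_sum_inter_eval _ 1 hAm]
  simp only [hfib]
  rw [← ENNReal.ofReal_sum_of_nonneg, ← Finset.mul_sum,
    ← h.backward_of_le hp (t _).2.1 (t _).2.2 le_rfl]
  · congr 1
    simp only [doobTransform]
    rw [Finset.prod_mul_distrib, Fin.prod_succ_div_castSucc (fun i => φ (t i) (x i))
      fun i => (hpos _ _).ne']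
    simp only [h0, Set.Icc.coe_zero]
    ring
  · intro y _
    exact mul_nonneg (div_nonneg (mul_nonneg (hμ _) hprod) (hpos 0 _).le)
      (mul_nonneg (hp.nonneg _ _ (t _).2.1 (t _).2.2 le_rfl _ _) (h.terminal_pos hν y).le)

theorem IsSBPotentials.exists_pathMeasure (h : IsSBPotentials p μ ν φ φh)
    (hp : IsTransitionFunction r p) (hν : ∀ x, 0 < ν x) (hμ : μ ∈ stdSimplex ℝ X)
    {R : Measure (CadlagPath X)} (hR : IsMarkovLaw μ p R) :
    IsPathMeasure μ (sbRate r φ) (R.tilted (logDensity φ)) ∧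
      HasTerminalLaw ν (R.tilted (logDensity φ)) ∧
      Integrable (fun ω => Real.exp (logDensity φ ω)) R ∧
      ∫ ω, Real.exp (logDensity φ ω) ∂(R) = 1 := by
  have hq := h.isTransitionFunction_doobTransform hp hν
  have hP := h.isMarkovLaw_withDensity hp hν hμ.1 hR
  have hmeas : Measurable fun ω : CadlagPath X => Real.exp (logDensity φ ω) :=
    (measurable_logDensity φ).exp
  -- The normalisation is read off from the reweighted measure being a Markov law started from `μ`.
  have hlint : ∫⁻ ω, ENNReal.ofReal (Real.exp (logDensity φ ω)) ∂(R) = 1 := by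
    have h1 := (hP.isProbabilityMeasure hμ).measure_univ
    rwa [withDensity_apply _ MeasurableSet.univ, Measure.restrict_univ] at h1
  have hone : ∫ ω, Real.exp (logDensity φ ω) ∂(R) = 1 := by
    rw [integral_eq_lintegral_of_nonneg_ae (ae_of_all _ fun _ => (Real.exp_pos _).le)
      hmeas.aestronglyMeasurable, hlint, ENNReal.toReal_one]
  have htilt : R.tilted (logDensity φ) =
      R.withDensity fun ω => ENNReal.ofReal (Real.exp (logDensity φ ω)) := by
    simp only [Measure.tilted, hone, div_one]
  rw [htilt]
  refine ⟨⟨_, hq, hP⟩, fun y => ?_, ?_, hone⟩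
  · rw [hP.measure_eval_one hμ.1 (fun x y => hq.nonneg 0 1 le_rfl zero_le_one le_rfl y x),
      h.sum_mul_doobTransform hp hν]
  -- The Bochner integral of a non-integrable function is 0, so the value 1 forces integrability.
  · exact Integrable.of_integral_ne_zero (by rw [hone]; exact one_ne_zero)

end Potentials

/-! ### Optimality for both problems. -/

theorem mainTheorem2 {X : Type*} [Fintype X] [DecidableEq X]
    (μ ν : X → ℝ) (hμ : μ ∈ stdSimplex ℝ X) (hν : ν ∈ stdSimplex ℝ X) (hν_pos : ∀ x, 0 < ν x)
    (r : ℝ → X → X → ℝ) (p : ℝ → ℝ → X → X → ℝ) (hp : IsTransitionFunction r p)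
    (R : Measure (CadlagPath X)) (hR : IsMarkovLaw μ p R) :
    ((∀ x y, 0 < p 0 1 y x) → ∃ φ φh, IsSBPotentials p μ ν φ φh) ∧
    ∀ φ φh : ℝ → X → ℝ, IsSBPotentials p μ ν φ φh →
      IsSBSolution R μ ν (sbRate r φ) ∧
      IsSOCSolution R μ (fun x => Real.log (φh 1 x / ν x)) (sbRate r φ) ∧
      ∀ u : ℝ → X → X → ℝ, IsSBSolution R μ ν u →
        IsSOCSolution R μ (fun x => Real.log (φh 1 x / ν x)) u := by
  refine ⟨exists_isSBPotentials hμ hν hν_pos hp, fun φ φh h => ?_⟩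
  have hRprob := hR.isProbabilityMeasure hμ
  obtain ⟨hpath, hterm, hexp, hone⟩ := h.exists_pathMeasure hp hν_pos hμ hR
  set P := R.tilted (logDensity φ)
  set g : X → ℝ := fun x => Real.log (φh 1 x / ν x) with hg
  have hprob : ∀ {u' P'}, IsPathMeasure μ u' P' → IsProbabilityMeasure P' :=
    fun ⟨_, _, h'⟩ => h'.isProbabilityMeasure hμ
  have hPprob := hprob hpath
  have hinit : ∀ {u' P'}, IsPathMeasure μ u' P' → ∀ φ0 : X → ℝ,
      ∫ ω, φ0 (ω.toFun 0) ∂P' = ∑ x, μ x * φ0 x := by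
    intro u' P' hP' φ0
    have := hprob hP'
    obtain ⟨_, _, h'⟩ := hP'
    exact CadlagPath.integral_comp_eval P' hμ.1 h'.measure_eval_zero φ0
  -- The last sum is the same for all competitors, since they share the initial law.
  have hlog : ∀ {u' P'}, IsPathMeasure μ u' P' → ∫ ω, logDensity φ ω ∂P' =
      -∫ ω, g (ω.toFun 1) ∂P' - ∑ x, μ x * Real.log (φ 0 x) := by
    intro u' P' hP'
    have := hprob hP'
    rw [← hinit hP' fun x => Real.log (φ 0 x), ← integral_neg]
    simp only [hg, h.log_hat_div hν_pos, neg_neg, logDensity]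
    exact integral_sub (CadlagPath.integrable_comp_eval P' (fun x => Real.log (φ 1 x)) 1)
      (CadlagPath.integrable_comp_eval P' (fun x => Real.log (φ 0 x)) 0)
  have hgterm : ∀ {P' : Measure (CadlagPath X)}, IsProbabilityMeasure P' → HasTerminalLaw ν P' →
      ∫ ω, g (ω.toFun 1) ∂P' = ∑ x, ν x * g x :=
    fun _ hP' => CadlagPath.integral_comp_eval _ hν.1 hP' g
  obtain ⟨htopP, hkl⟩ := klDiv_tilted_self hexp hone (integrable_logDensity φ P)
  have hsb : ∀ u' P', IsPathMeasure μ u' P' → HasTerminalLaw ν P' →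
      InformationTheory.klDiv P R ≤ InformationTheory.klDiv P' R := by
    intro u' P' hP' hν'
    have := hprob hP'
    by_cases htop : InformationTheory.klDiv P' R = ∞
    · rw [htop]; exact le_top
    rw [← ENNReal.toReal_le_toReal htopP htop, hkl, hlog hpath, hgterm hPprob hterm,
      ← hgterm this hν', ← hlog hP']
    exact integral_le_toReal_klDiv hexp hone (integrable_logDensity φ P') htop
  have hsoc : ∀ u' P', IsPathMeasure μ u' P' → socCost R g P ≤ socCost R g P' := by
    intro u' P' hP'
    have := hprob hP'
    by_cases htop : InformationTheory.klDiv P' R = ∞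
    -- The expected terminal cost is a real number, so infinite divergence makes the whole cost `⊤`.
    · simp [socCost, htop]
    have hle := integral_le_toReal_klDiv hexp hone (integrable_logDensity φ P') htop
    rw [hlog hP'] at hle
    have hreal := hkl
    rw [hlog hpath] at hreal
    rw [socCost, socCost, ← EReal.coe_ennreal_toReal htop, ← EReal.coe_ennreal_toReal htopP,
      ← EReal.coe_add, ← EReal.coe_add, EReal.coe_le_coe_iff]
    linarith
  refine ⟨⟨P, hpath, hterm, hsb⟩, ⟨P, hpath, hsoc⟩, ?_⟩
  rintro u ⟨Q, hQ, hQν, hmin⟩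
  refine ⟨Q, hQ, fun u' P' hP' => le_trans ?_ (hsoc u' P' hP')⟩
  -- `Q` and `P` both end in `ν`, so their terminal costs agree and only the divergences need
  -- comparing.
  rw [socCost, socCost, hgterm (hprob hQ) hQν, hgterm hPprob hterm]
  exact add_le_add_left (EReal.coe_ennreal_le_coe_ennreal_iff.2 (hmin _ P hpath hterm)) _
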